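/- Let $X$ be a compact connected (Hausdorff) complex manifold of complex dimension $m$ whose first Betti number $b_1(X)=\operatorname{rank} H_1(X;\mathbb Z)$ is positive, and let $n\ge 1$. Let $B^n\subset\mathbb C^n$ be the open Euclidean unit ball. Then there is a flat holomorphic $B^n$-bundle $p:\Omega\to X$ (that is, $\Omega$ is an $(m+n)$-dimensional complex manifold, and $X$ is covered by open sets $U$ with biholomorphic trivializations $p^{-1}(U)\cong U\times B^n$ over $U$ whose transition functions, with values in $\operatorname{Aut}(B^n)$, are locally constant) such that: (1) there is a real-analytic bounded plurisubharmonic exhaustion function $\rho:\Omega\to\mathbb R$ (that is, $\rho$ is bounded and, for some $c\in\mathbb R$, $\rho<c$ on $\Omega$ and $\{\rho\le t\}$ is compact for every $t<c$) such that at every point of $\Omega$ the complex Hessian $\left(\partial^2\rho/\partial z_j\partial\bar z_k\right)$ of $\rho$ in local holomorphic coordinates has exactly $n$ positive eigenvalues, counted with multiplicity; (2) every holomorphic function $f:\Omega\to\mathbb C$ is constant. -/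

import Mathlib

open scoped Manifold ContDiff Topology

universe u

/-- The first Betti number of `X`: the rank of the singular homology group `H₁(X; ℤ)`. -/
noncomputable def firstBettiNumber (X : Type u) [TopologicalSpace X] : Cardinal.{u} :=
  Module.rank ℤ
    (((AlgebraicTopology.singularHomologyFunctor (ModuleCat.{u} ℤ) 1).obj
      (ModuleCat.of ℤ (ULift.{u} ℤ))).obj (TopCat.of X))

/-- The open unit ball of `ℂⁿ` (Euclidean norm), as a complex manifold. -/
def unitBall (n : ℕ) : TopologicalSpace.Opens (EuclideanSpace ℂ (Fin n)) :=
  ⟨Metric.ball 0 1, Metric.isOpen_ball⟩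

/-- `p : Ω → X` is a flat holomorphic fibre bundle with fibre `F`: there are biholomorphic local
trivializations `p ⁻¹(U) ≃ U × F` over open sets `U` covering `X` whose transition functions
(with values in the automorphisms of `F`) are locally constant. -/
def IsFlatBundle {EX HX EF HF EΩ HΩ : Type*}
    [NormedAddCommGroup EX] [NormedSpace ℂ EX] [TopologicalSpace HX]
    [NormedAddCommGroup EF] [NormedSpace ℂ EF] [TopologicalSpace HF]
    [NormedAddCommGroup EΩ] [NormedSpace ℂ EΩ] [TopologicalSpace HΩ]
    (IX : ModelWithCorners ℂ EX HX) (IF : ModelWithCorners ℂ EF HF)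
    (IΩ : ModelWithCorners ℂ EΩ HΩ)
    {X Ω : Type*} [TopologicalSpace X] [ChartedSpace HX X]
    [TopologicalSpace Ω] [ChartedSpace HΩ Ω]
    (F : Type*) [TopologicalSpace F] [ChartedSpace HF F] (p : Ω → X) : Prop :=
  ∃ A : Set (Bundle.Trivialization F p),
    (∀ x : X, ∃ e ∈ A, x ∈ e.baseSet) ∧
    (∀ e ∈ A, e.toOpenPartialHomeomorph.MDifferentiable IΩ (IX.prod IF)) ∧
    (∀ e ∈ A, ∀ e' ∈ A, ∀ x ∈ e.baseSet ∩ e'.baseSet,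
      ∀ᶠ y in 𝓝 x, ∀ v : F, e.coordChange e' y v = e.coordChange e' x v)

section Functions

variable {V : Type*} [NormedAddCommGroup V] [NormedSpace ℂ V]

/-- `u` is plurisubharmonic on the open set `U`: it is upper semicontinuous and satisfies the
sub-mean value inequality on every closed affine complex disc contained in `U`. (For a real-valued
`u` the integrals are then finite, which is recorded as `CircleIntegrable`.) -/
def PlurisubharmonicOn (u : V → ℝ) (U : Set V) : Prop :=
  UpperSemicontinuousOn u U ∧
    ∀ a b : V, (∀ ζ : ℂ, ‖ζ‖ ≤ 1 → a + ζ • b ∈ U) →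
      CircleIntegrable (fun ζ : ℂ => u (a + ζ • b)) 0 1 ∧
        u a ≤ Real.circleAverage (fun ζ : ℂ => u (a + ζ • b)) 0 1

/-- The Wirtinger derivative of `f` in the direction `v`; for the `j`-th vector of a basis it
is `∂f/∂z_j` in the corresponding linear coordinates. -/
noncomputable def wirtingerDeriv (v : V) (f : V → ℂ) (x : V) : ℂ :=
  (1 / 2) * (fderiv ℝ f x v - Complex.I * fderiv ℝ f x (Complex.I • v))

/-- The conjugate Wirtinger derivative of `f` in the direction `v`; for the `j`-th vector of a
basis it is `∂f/∂z̄_j` in the corresponding linear coordinates. -/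
noncomputable def wirtingerDerivBar (v : V) (f : V → ℂ) (x : V) : ℂ :=
  (1 / 2) * (fderiv ℝ f x v + Complex.I * fderiv ℝ f x (Complex.I • v))

/-- The complex Hessian matrix `(∂²u/∂z_j∂z̄_k)` in the linear coordinates of the basis `b`. -/
noncomputable def complexHessian {ι : Type*} (b : Module.Basis ι ℂ V) (u : V → ℝ) (x : V) :
    Matrix ι ι ℂ :=
  Matrix.of fun j k =>
    wirtingerDeriv (b j) (wirtingerDerivBar (b k) (fun y => (u y : ℂ))) x

variable {M : Type*} [TopologicalSpace M] [ChartedSpace V M]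

variable (V) in
/-- Real analytic functions on a complex manifold modelled on `V`. -/
def IsRealAnalytic (ρ : M → ℝ) : Prop :=
  ContMDiff 𝓘(ℝ, V) 𝓘(ℝ, ℝ) ω ρ

variable (V) in
/-- Plurisubharmonic functions on a complex manifold modelled on `V`. -/
def IsPlurisubharmonic (ρ : M → ℝ) : Prop :=
  ∀ e ∈ atlas V M, PlurisubharmonicOn (ρ ∘ e.symm) e.target

/-- At every point, the complex Hessian of `ρ` in local holomorphic coordinates (a Hermitian
matrix) has exactly `n` positive eigenvalues, counted with multiplicity. -/
def HessianHasPositiveEigenvalues {ι : Type*} [Fintype ι] [DecidableEq ι]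
    (b : Module.Basis ι ℂ V) (n : ℕ) (ρ : M → ℝ) : Prop :=
  ∀ e ∈ atlas V M, ∀ x ∈ e.target,
    ∃ h : (complexHessian b (ρ ∘ e.symm) x).IsHermitian,
      Nat.card {i : ι // 0 < h.eigenvalues i} = n

end Functions

/-- `ρ` is a bounded exhaustion function: it is bounded, and for some `c` it takes its values
in `(-∞, c)` and has compact sublevel sets at all levels below `c`. -/
def IsBoundedExhaustion {M : Type*} [TopologicalSpace M] (ρ : M → ℝ) : Prop :=
  Bornology.IsBounded (Set.range ρ) ∧
    ∃ c : ℝ, (∀ x, ρ x < c) ∧ ∀ t < c, IsCompact {x | ρ x ≤ t}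

/-- The standard basis of `ℂᵐ × ℂⁿ`. -/
noncomputable def stdBasisProd (m n : ℕ) :
    Module.Basis (Fin m ⊕ Fin n) ℂ (EuclideanSpace ℂ (Fin m) × EuclideanSpace ℂ (Fin n)) :=
  (EuclideanSpace.basisFun (Fin m) ℂ).toBasis.prod (EuclideanSpace.basisFun (Fin n) ℂ).toBasis

/-! ### Homology classes of infinite order and circle-valued cocycles. -/

section Homology

open CategoryTheory Limits Simplicial

/-! The bundle comes from a unitary representation with dense image. Since `b₁ > 0`, there is a
class of infinite order in `H₁`; the circle is divisible, hence injective as an abelian group, so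
some circle-valued character takes a value of infinite order on that class. The periods are then
dense in the circle. To avoid the fundamental group and universal covers, the character is kept as a
multiplicative function on paths (`CircleCocycle`, `exists_circleCocycle`). On convex charts it has
primitives, and their quotients are locally constant scalars of modulus one, which serve as
transition functions of a flat ball bundle.

Scalars of modulus one preserve the norm, so `ρ = ‖w‖²` is globally defined. In product charts its
Hessian is `diag(0, 1)`, and it exhausts because `X` is compact.

For `f` holomorphic and `t < 1`, let `|f|` attain its maximum over `{ρ ≤ t}` at a point with fibre
coordinate `v`. By the maximum principle along the flat leaves (`apply_eq_iff_of_path`), `f` keeps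
its value `M` there along the leaf; by density of the periods, `f = M` at `c • v` over every base
point, for all unit `c` (`apply_eq_of_dense`). In each fibre, the disc `ζ ↦ ζ • v` gives `f = M` at
the centre, which is an interior maximum, so `f = M` on `{ρ < t}` (`apply_fiber_eq_of_isMaxOn`). -/

theorem AddCircle.exists_addOrderOf_eq_zero : ∃ θ : AddCircle (1 : ℝ), addOrderOf θ = 0 := by
  refine ⟨((√2 : ℝ) : AddCircle (1 : ℝ)), ?_⟩
  rw [← AddCircle.denseRange_zsmul_iff, AddCircle.denseRange_zsmul_coe_iff]
  simpa using irrational_sqrt_two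

/-- A homology class of infinite order is detected by an additive character of the chains with
values in the circle. -/
theorem HomologicalComplex.exists_addCircle_character
    (K : ChainComplex (ModuleCat.{u} ℤ) ℕ) (i : ℕ) (h : 0 < Module.rank ℤ (K.homology i)) :
    ∃ (ψ : K.X i →ₗ[ℤ] AddCircle (1 : ℝ)) (c : K.X i),
      (∀ y : K.X (i + 1), ψ (K.d (i + 1) i y) = 0) ∧ (∀ j, K.d i j c = 0) ∧
        addOrderOf (ψ c) = 0 := by
  obtain ⟨x, hx⟩ : ∃ x : K.homology i, ∀ a : ℤ,
      LinearMap.toSpanSingleton ℤ (K.homology i) x a = 0 → a = 0 := by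
    by_contra! hcon
    exact h.ne' (rank_eq_zero_iff.2 fun x => (hcon x).imp fun a ha => ⟨ha.2, ha.1⟩)
  obtain ⟨z, rfl⟩ := (ModuleCat.epi_iff_surjective (K.homologyπ i)).1 inferInstance x
  have hι := (ModuleCat.mono_iff_injective (K.homologyι i)).1 inferInstance
  obtain ⟨θ, hθ⟩ := AddCircle.exists_addOrderOf_eq_zero
  -- Extending from the opcycles (chains modulo boundaries), into which homology embeds, yields at
  -- once a character of all chains that kills boundaries.
  obtain ⟨g, hg⟩ := (Module.Baer.of_divisible (AddCircle (1 : ℝ))).extension_property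
    ((K.homologyι i).hom ∘ₗ LinearMap.toSpanSingleton ℤ _ (K.homologyπ i z))
    (by
      refine hι.comp ((injective_iff_map_eq_zero _).2 fun a ha => ?_)
      exact hx a ha)
    (LinearMap.toSpanSingleton ℤ _ θ)
  refine ⟨g ∘ₗ (K.pOpcycles i).hom, K.iCycles i z, fun y => ?_, fun j => ?_, ?_⟩
  · have : K.pOpcycles i (K.d (i + 1) i y) = 0 := by
      rw [← ConcreteCategory.comp_apply, K.d_pOpcycles]; rfl
    change g (K.pOpcycles i (K.d (i + 1) i y)) = 0
    rw [this, map_zero]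
  · rw [← ConcreteCategory.comp_apply, K.iCycles_d]; rfl
  · have h1 := LinearMap.congr_fun hg 1
    have h2 : K.pOpcycles i (K.iCycles i z) = K.homologyι i (K.homologyπ i z) := by
      rw [← ConcreteCategory.comp_apply, ← ConcreteCategory.comp_apply, K.homology_π_ι]
    change addOrderOf (g (K.pOpcycles i (K.iCycles i z))) = 0
    rw [h2]
    simp only [LinearMap.comp_apply, LinearMap.toSpanSingleton_apply_one] at h1
    exact (congrArg addOrderOf h1).trans hθ

theorem ModuleCat.hom_ext_ulift_int {T : ModuleCat.{u} ℤ}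
    {f g : ModuleCat.of ℤ (ULift.{u} ℤ) ⟶ T} (h : f (ULift.up 1) = g (ULift.up 1)) : f = g := by
  refine ModuleCat.hom_ext (LinearMap.ext fun x => ?_)
  have hx : x = x.down • (ULift.up 1 : ULift.{u} ℤ) := by ext; simp
  rw [hx]
  exact (f.hom.map_smul x.down (ULift.up 1)).trans
    ((congrArg _ h).trans (g.hom.map_smul x.down (ULift.up 1)).symm)

/-- A simplicial set whose first homology has positive rank carries a `1`-cocycle with values in
the circle whose periods contain an element of infinite order. -/
theorem SSet.exists_addCircle_cocycle (S : SSet.{u})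
    (h : 0 < Module.rank ℤ (S.homology (ModuleCat.of ℤ (ULift.{u} ℤ)) 1 : ModuleCat.{u} ℤ)) :
    ∃ φ : S _⦋1⦌ → AddCircle (1 : ℝ),
      (∀ τ : S _⦋2⦌, φ (S.δ 1 τ) = φ (S.δ 0 τ) + φ (S.δ 2 τ)) ∧
      ∀ (G : AddSubgroup (AddCircle (1 : ℝ))) (s : S _⦋0⦌ → AddCircle (1 : ℝ)),
        (∀ σ : S _⦋1⦌, φ σ + s (S.δ 1 σ) - s (S.δ 0 σ) ∈ G) → ∃ g ∈ G, addOrderOf g = 0 := by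
  obtain ⟨ψ, c, hψ, hc, hθ⟩ := HomologicalComplex.exists_addCircle_character
    (S.chainComplex (ModuleCat.of ℤ (ULift.{u} ℤ))) 1 h
  have hd {n : ℕ} (τ : S _⦋n + 1⦌) :
      (S.chainComplex (ModuleCat.of ℤ (ULift.{u} ℤ))).d (n + 1) n
          (S.ιChainComplex (R := ModuleCat.of ℤ (ULift.{u} ℤ)) τ (ULift.up 1)) =
        ∑ i : Fin (n + 2), (-1 : ℤ) ^ i.val •
          (S.ιChainComplex (R := ModuleCat.of ℤ (ULift.{u} ℤ)) (S.δ i τ) (ULift.up 1)) := by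
    rw [← ConcreteCategory.comp_apply, SSet.ιChainComplex_d]
    simp
  refine ⟨fun σ => ψ (S.ιChainComplex (R := ModuleCat.of ℤ (ULift.{u} ℤ)) σ (ULift.up 1)),
    fun τ => ?_, fun G s hs => ⟨_, ?_, hθ⟩⟩
  · have := hψ (S.ιChainComplex (R := ModuleCat.of ℤ (ULift.{u} ℤ)) τ (ULift.up 1))
    rw [hd] at this
    simp [Fin.sum_univ_three] at this
    rw [← sub_eq_zero, ← neg_eq_zero, ← this]
    abel
  -- Modulo `G`, the hypothesis says that `ψ` is the coboundary of `s`, so it vanishes on the cycle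
  -- `c`; that is, `ψ c ∈ G`.
  · let T : ModuleCat.{u} ℤ := ModuleCat.of ℤ (ULift.{u} (AddCircle (1 : ℝ) ⧸ G))
    let f₁ : (S.chainComplex (ModuleCat.of ℤ (ULift.{u} ℤ))).X 1 ⟶ T :=
      ModuleCat.ofHom ((AddEquiv.ulift.symm.toAddMonoidHom.comp
        (QuotientAddGroup.mk' G)).toIntLinearMap.comp ψ)
    let f₀ : (S.chainComplex (ModuleCat.of ℤ (ULift.{u} ℤ))).X 0 ⟶ T :=
      Sigma.desc fun x : S _⦋0⦌ => ModuleCat.ofHom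
        ((LinearMap.toSpanSingleton ℤ T (ULift.up (QuotientAddGroup.mk' G (s x)))).comp
          (ULift.moduleEquiv (R := ℤ) (M := ℤ)).toLinearMap)
    have hf₀ (x : S _⦋0⦌) :
        f₀ (S.ιChainComplex (R := ModuleCat.of ℤ (ULift.{u} ℤ)) x (ULift.up 1)) =
          ULift.up (QuotientAddGroup.mk' G (s x)) := by
      have : S.ιChainComplex (R := ModuleCat.of ℤ (ULift.{u} ℤ)) x ≫ f₀ = _ :=
        Sigma.ι_desc _ x
      rw [← ConcreteCategory.comp_apply, this]
      simp
    have key : f₁ = (S.chainComplex (ModuleCat.of ℤ (ULift.{u} ℤ))).d 1 0 ≫ f₀ := by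
      refine SSet.chainComplex_hom_ext fun σ => ?_
      apply ModuleCat.hom_ext_ulift_int
      change f₁ (S.ιChainComplex (R := ModuleCat.of ℤ (ULift.{u} ℤ)) σ (ULift.up 1)) =
        f₀ ((S.chainComplex (ModuleCat.of ℤ (ULift.{u} ℤ))).d 1 0
          (S.ιChainComplex (R := ModuleCat.of ℤ (ULift.{u} ℤ)) σ (ULift.up 1)))
      rw [hd, map_sum]
      simp only [map_zsmul, hf₀]
      rw [Fin.sum_univ_two, Fin.val_zero, Fin.val_one, pow_zero, pow_one, one_smul, neg_one_smul,
        ← sub_eq_add_neg]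
      have hσ := (QuotientAddGroup.eq_zero_iff _).2 (hs σ)
      rw [QuotientAddGroup.mk_sub, QuotientAddGroup.mk_add, sub_eq_zero, ← eq_sub_iff_add_eq] at hσ
      exact congrArg ULift.up hσ
    have h0 : f₁ c = 0 := by
      rw [key, ConcreteCategory.comp_apply, hc, map_zero]
    exact (QuotientAddGroup.eq_zero_iff _).1 (congrArg ULift.down h0)

end Homology

/-! ### From singular simplices to paths. -/

section Paths
open CategoryTheory Simplicial Opposite unitInterval

theorem TopCat.toSSetObjEquiv_δ (X : TopCat.{u}) {n : ℕ} (i : Fin (n + 2))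
    (τ : (TopCat.toSSet.obj X) _⦋n + 1⦌) (x : stdSimplex ℝ (Fin (n + 1))) :
    X.toSSetObjEquiv (op ⦋n⦌) ((TopCat.toSSet.obj X).δ i τ) x =
      X.toSSetObjEquiv (op ⦋n + 1⦌) τ (stdSimplex.map i.succAbove x) := by
  rfl

theorem stdSimplex.map_fin_two_apply {κ : Type*} [Fintype κ] [DecidableEq κ] (f : Fin 2 → κ)
    (x : stdSimplex ℝ (Fin 2)) (j : κ) :
    stdSimplex.map f x j = (if f 0 = j then x 0 else 0) + if f 1 = j then x 1 else 0 := by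
  rw [stdSimplex.map_coe, FunOnFinite.linearMap_apply_apply, Finset.sum_filter, Fin.sum_univ_two]

/-- The triangle in `X` cut out of a square. -/
noncomputable def ContinuousMap.squareTriangle {X : Type*} [TopologicalSpace X] (τ : C(I × I, X)) :
    C(stdSimplex ℝ (Fin 3), X) where
  toFun x := τ (Set.projIcc 0 1 zero_le_one (x 1 + x 2), Set.projIcc 0 1 zero_le_one (x 2))
  continuous_toFun := by
    have h (i : Fin 3) : Continuous fun x : stdSimplex ℝ (Fin 3) => x i :=
      (continuous_apply i).comp continuous_subtype_val
    exact τ.continuous.comp ((continuous_projIcc.comp ((h 1).add (h 2))).prodMk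
      (continuous_projIcc.comp (h 2)))

theorem ContinuousMap.squareTriangle_apply {X : Type*} [TopologicalSpace X] (τ : C(I × I, X))
    (x : stdSimplex ℝ (Fin 3)) (a b : I) (ha : x 1 + x 2 = a) (hb : x 2 = b) :
    τ.squareTriangle x = τ (a, b) := by
  change τ (Set.projIcc 0 1 zero_le_one (x 1 + x 2), Set.projIcc 0 1 zero_le_one (x 2)) = _
  rw [ha, hb, Set.projIcc_val, Set.projIcc_val]

/-- A multiplicative function on the paths of `X` with values in the circle, compatible with
triangles. -/
structure CircleCocycle (X : Type*) [TopologicalSpace X] where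
  /-- The value on a path. -/
  toFun : C(I, X) → Circle
  triangle : ∀ τ : C(I × I, X), toFun (τ.comp ((ContinuousMap.id I).prodMk (.id I))) =
    toFun (τ.comp ((ContinuousMap.id I).prodMk (.const I 0))) *
      toFun (τ.comp ((ContinuousMap.const I 1).prodMk (.id I)))

/-- The function `s` stands for a change of gauge: however the cocycle is altered by a coboundary,
the group containing its values stays dense. No continuity of `s` is needed, so base paths may later
be chosen arbitrarily. -/
theorem exists_circleCocycle (X : Type u) [TopologicalSpace X] (h : 0 < firstBettiNumber X) :
    ∃ χ : CircleCocycle X, ∀ (G : Subgroup Circle) (s : X → Circle),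
      (∀ γ : C(I, X), χ.toFun γ * s (γ 0) / s (γ 1) ∈ G) → Dense (G : Set Circle) := by
  obtain ⟨φ, hφ, hG⟩ := (TopCat.toSSet.obj (TopCat.of X)).exists_addCircle_cocycle h
  let simplex (γ : C(I, X)) : (TopCat.toSSet.obj (TopCat.of X)) _⦋1⦌ :=
    ((TopCat.of X).toSSetObjEquiv (op ⦋1⦌)).symm
      (γ.comp (stdSimplexHomeomorphUnitInterval : C(stdSimplex ℝ (Fin 2), I)))
  have hsimplex (γ : C(I, X)) (x : stdSimplex ℝ (Fin 2)) :
      (TopCat.of X).toSSetObjEquiv (op ⦋1⦌) (simplex γ) x =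
        γ (stdSimplexHomeomorphUnitInterval x) :=
    DFunLike.congr_fun (((TopCat.of X).toSSetObjEquiv (op ⦋1⦌)).apply_symm_apply _) x
  refine ⟨⟨fun γ => (φ (simplex γ)).toCircle, fun τ => ?_⟩, fun G s hs => ?_⟩
  · let T : (TopCat.toSSet.obj (TopCat.of X)) _⦋2⦌ :=
      ((TopCat.of X).toSSetObjEquiv (op ⦋2⦌)).symm τ.squareTriangle
    have hT (x : stdSimplex ℝ (Fin 3)) :
        (TopCat.of X).toSSetObjEquiv (op ⦋2⦌) T x = τ.squareTriangle x :=
      DFunLike.congr_fun (((TopCat.of X).toSSetObjEquiv (op ⦋2⦌)).apply_symm_apply _) x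
    have face (i : Fin 3) (γ : C(I, X))
        (hγ : ∀ x : stdSimplex ℝ (Fin 2), τ.squareTriangle (stdSimplex.map i.succAbove x) =
          γ (stdSimplexHomeomorphUnitInterval x)) :
        (TopCat.toSSet.obj (TopCat.of X)).δ i T = simplex γ := by
      refine ((TopCat.of X).toSSetObjEquiv (op ⦋1⦌)).injective (ContinuousMap.ext fun x => ?_)
      exact ((TopCat.toSSetObjEquiv_δ (TopCat.of X) i T x).trans (hT _)).trans
        ((hγ x).trans (hsimplex γ x).symm)
    have hx (x : stdSimplex ℝ (Fin 2)) :
        ((stdSimplexHomeomorphUnitInterval x : I) : ℝ) = x 1 := rfl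
    have e0 (i : Fin 3) (x : stdSimplex ℝ (Fin 2)) (j : Fin 3) :=
      stdSimplex.map_fin_two_apply i.succAbove x j
    -- The vertices of the triangle go to `(0,0)`, `(1,0)`, `(1,1)`, so faces 1, 2, 0 are the
    -- diagonal, the bottom and the right edge of the square.
    rw [← face 1 _ fun x => ?_, ← face 2 _ fun x => ?_, ← face 0 _ fun x => ?_, hφ,
      AddCircle.toCircle_add, mul_comm]
    · refine τ.squareTriangle_apply _ _ _ ?_ ?_
      · rw [e0, e0, if_pos (by decide), if_neg (by decide), if_neg (by decide),
          if_pos (by decide)]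
        simpa using stdSimplex.add_eq_one x
      · rw [e0, if_neg (by decide), if_pos (by decide)]
        simp [hx]
    · refine τ.squareTriangle_apply _ _ _ ?_ ?_
      · rw [e0, e0, if_neg (by decide), if_pos (by decide), if_neg (by decide),
          if_neg (by decide)]
        simp [hx]
      · rw [e0, if_neg (by decide), if_neg (by decide)]
        simp
    · refine τ.squareTriangle_apply _ _ _ ?_ ?_
      · rw [e0, e0, if_neg (by decide), if_neg (by decide), if_neg (by decide),
          if_pos (by decide)]
        simp [hx]
      · rw [e0, if_neg (by decide), if_pos (by decide)]
        simp [hx]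
  · let e := AddCircle.homeomorphCircle (T := 1) one_ne_zero
    have he (x : AddCircle (1 : ℝ)) : e x = x.toCircle := AddCircle.homeomorphCircle_apply _ x
    let pt (x : (TopCat.toSSet.obj (TopCat.of X)) _⦋0⦌) : X :=
      (TopCat.of X).toSSetObjEquiv (op ⦋0⦌) x (stdSimplex.vertex 0)
    let F : AddCircle (1 : ℝ) →+ Additive Circle := AddMonoidHom.mk'
      (fun x => Additive.ofMul x.toCircle) AddCircle.toCircle_add
    obtain ⟨g, hg, hgo⟩ := hG (G.toAddSubgroup.comap F) (fun x => e.symm (s (pt x))) fun c => by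
      let γ : C(I, X) := ((TopCat.of X).toSSetObjEquiv (op ⦋1⦌) c).comp
        (stdSimplexHomeomorphUnitInterval.symm : C(I, stdSimplex ℝ (Fin 2)))
      have hc : simplex γ = c := by
        refine ((TopCat.of X).toSSetObjEquiv (op ⦋1⦌)).injective (ContinuousMap.ext fun x => ?_)
        refine (hsimplex γ x).trans ?_
        exact congrArg ((TopCat.of X).toSSetObjEquiv (op ⦋1⦌) c)
          (stdSimplexHomeomorphUnitInterval.symm_apply_apply x)
      have h0 : pt ((TopCat.toSSet.obj (TopCat.of X)).δ 1 c) = γ 0 := by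
        refine (TopCat.toSSetObjEquiv_δ (TopCat.of X) 1 c _).trans ?_
        rw [stdSimplex.map_vertex]
        refine congrArg _ ((stdSimplexHomeomorphUnitInterval.eq_symm_apply).2 ?_)
        exact stdSimplexHomeomorphUnitInterval_zero
      have h1 : pt ((TopCat.toSSet.obj (TopCat.of X)).δ 0 c) = γ 1 := by
        refine (TopCat.toSSetObjEquiv_δ (TopCat.of X) 0 c _).trans ?_
        rw [stdSimplex.map_vertex]
        refine congrArg _ ((stdSimplexHomeomorphUnitInterval.eq_symm_apply).2 ?_)
        exact stdSimplexHomeomorphUnitInterval_one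
      have := hs γ
      simp only [hc] at this
      simp only [h0, h1]
      change AddCircle.toCircle _ ∈ G
      rw [sub_eq_add_neg, AddCircle.toCircle_add, AddCircle.toCircle_add, AddCircle.toCircle_neg,
        ← he (e.symm _), ← he (e.symm _), e.apply_symm_apply, e.apply_symm_apply, ← div_eq_mul_inv]
      exact this
    -- The multiples of a single element of infinite order are already dense.
    have hd := e.surjective.denseRange.comp (AddCircle.denseRange_zsmul_iff.2 hgo) e.continuous
    refine hd.mono ?_
    rintro _ ⟨n, rfl⟩
    change e (n • g) ∈ G
    rw [he, AddCircle.toCircle_zsmul]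
    exact G.zpow_mem hg n

end Paths

/-! ### Primitives of the cocycle on convex charts. -/

section Primitives
open unitInterval

namespace CircleCocycle

variable {X : Type*} [TopologicalSpace X] (χ : CircleCocycle X)

theorem map_const (x : X) : χ.toFun (.const I x) = 1 := by
  have h : χ.toFun (.const I x) = χ.toFun (.const I x) * χ.toFun (.const I x) :=
    χ.triangle (.const (I × I) x)
  exact (mul_eq_left.1 h.symm)

/-- The affinely reparametrized restriction of a path to the interval from `a` to `b`. -/
noncomputable def subpath (γ : C(I, X)) (a b : I) : C(I, X) :=
  γ.comp ⟨fun t => Set.projIcc 0 1 zero_le_one ((a : ℝ) + t * (b - a)),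
    continuous_projIcc.comp (by fun_prop)⟩

theorem subpath_apply (γ : C(I, X)) (a b t : I) :
    subpath γ a b t = γ (Set.projIcc 0 1 zero_le_one ((a : ℝ) + t * (b - a))) := rfl

theorem subpath_zero (γ : C(I, X)) (a b : I) : subpath γ a b 0 = γ a := by
  simp [subpath_apply]

theorem subpath_one (γ : C(I, X)) (a b : I) : subpath γ a b 1 = γ b := by
  simp [subpath_apply]

theorem subpath_zero_one (γ : C(I, X)) : subpath γ 0 1 = γ := by
  ext t; simp [subpath_apply]

theorem subpath_self (γ : C(I, X)) (a : I) : subpath γ a a = .const I (γ a) := by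
  ext t; simp [subpath_apply]

/-- The triangle relation is applied to `γ` composed with the affine map taking `(0,0)`, `(1,0)`,
`(1,1)` to `a`, `b`, `c`. No order among the three is needed; the clamp only acts outside this
triangle. -/
theorem map_subpath_mul (γ : C(I, X)) (a b c : I) :
    χ.toFun (subpath γ a b) * χ.toFun (subpath γ b c) = χ.toFun (subpath γ a c) := by
  let τ : C(I × I, X) :=
    γ.comp ⟨fun p => Set.projIcc 0 1 zero_le_one ((a : ℝ) + p.1 * (b - a) + p.2 * (c - b)),
      continuous_projIcc.comp (by fun_prop)⟩
  convert (χ.triangle τ).symm using 3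
  · ext t; simp [subpath_apply, τ]
  · ext t; simp [subpath_apply, τ]
  · ext t
    simp only [subpath_apply, τ, ContinuousMap.comp_apply, ContinuousMap.coe_mk,
      ContinuousMap.prod_eval, ContinuousMap.id_apply]
    congr 2
    ring

/-- The primitive at `y` is the cocycle on the segment from `p` to `y`. Coning a path `γ` off to `p`
gives a square with one edge collapsed; comparing its two triangles gives the formula. -/
theorem exists_primitive {E : Type*} [NormedAddCommGroup E] [NormedSpace ℝ E]
    (e : OpenPartialHomeomorph X E) (he : Convex ℝ e.target) {p : X} (hp : p ∈ e.source) :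
    ∃ h : X → Circle, h p = 1 ∧
      ∀ γ : C(I, X), (∀ t, γ t ∈ e.source) → h (γ 1) = h (γ 0) * χ.toFun γ := by
  have hmem (y : X) (hy : y ∈ e.source) (s : I) :
      AffineMap.lineMap (e p) (e y) (s : ℝ) ∈ e.target :=
    he.lineMap_mem (e.map_source hp) (e.map_source hy) s.2
  have hR (y : X) : ∃ R : C(I, X), y ∈ e.source →
      ∀ t, R t = e.symm (AffineMap.lineMap (e p) (e y) (t : ℝ)) := by
    by_cases hy : y ∈ e.source
    · exact ⟨⟨_, e.continuousOn_symm.comp_continuous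
        (AffineMap.lineMap_continuous.comp continuous_subtype_val) (hmem y hy)⟩,
        fun _ _ => rfl⟩
    -- Outside the chart any path will do.
    · exact ⟨.const I p, fun h => (hy h).elim⟩
  choose R hR using hR
  refine ⟨fun y => χ.toFun (R y), ?_, fun γ hγ => ?_⟩
  · have : R p = .const I p := by
      ext t
      simp [hR p hp, e.left_inv hp]
    exact (congrArg χ.toFun this).trans (χ.map_const p)
  · have hc : Continuous fun q : I × I => AffineMap.lineMap (e p) (e (γ q.2)) (q.1 : ℝ) := by
      have : Continuous fun q : I × I => e (γ q.2) :=
        e.continuousOn.comp_continuous (γ.continuous.comp continuous_snd) fun q => hγ _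
      have hq : Continuous fun q : I × I => (q.1 : ℝ) := continuous_subtype_val.comp continuous_fst
      simp only [AffineMap.lineMap_apply_module]
      exact ((continuous_const.sub hq).smul continuous_const).add (hq.smul this)
    let τ : C(I × I, X) := ⟨_, e.continuousOn_symm.comp_continuous hc fun q => hmem _ (hγ _) _⟩
    have hτ (s t : I) : τ (s, t) = e.symm (AffineMap.lineMap (e p) (e (γ t)) (s : ℝ)) := rfl
    have h1 := χ.triangle τ
    have h2 := χ.triangle (τ.comp .prodSwap)
    have e1 : τ.comp ((ContinuousMap.id I).prodMk (.const I 0)) = R (γ 0) := by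
      ext t; simp [hR _ (hγ 0), hτ]
    have e2 : τ.comp ((ContinuousMap.const I 1).prodMk (.id I)) = γ := by
      ext t; simp [hτ, e.left_inv (hγ t)]
    have e3 : (τ.comp .prodSwap).comp ((ContinuousMap.id I).prodMk (.const I 0)) = .const I p := by
      ext t; simp [hτ, e.left_inv hp]
    have e4 : (τ.comp .prodSwap).comp ((ContinuousMap.const I 1).prodMk (.id I)) = R (γ 1) := by
      ext t; simp [hR _ (hγ 1), hτ]
    have e5 : (τ.comp .prodSwap).comp ((ContinuousMap.id I).prodMk (.id I)) =
        τ.comp ((ContinuousMap.id I).prodMk (.id I)) := rfl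
    rw [e1, e2] at h1
    rw [e3, e4, e5, χ.map_const, one_mul, h1] at h2
    exact h2.symm

end CircleCocycle

variable {E : Type*} [NormedAddCommGroup E] {X : Type*} [TopologicalSpace X] [ChartedSpace E X]

theorem exists_ball_subset_chartAt_target (E : Type*) [NormedAddCommGroup E]
    {X : Type*} [TopologicalSpace X] [ChartedSpace E X] (x : X) :
    ∃ r > 0, Metric.ball (chartAt E x x) r ⊆ (chartAt E x).target :=
  Metric.isOpen_iff.1 (chartAt E x).open_target _ (mem_chart_target E x)

variable (E) in
/-- The preferred chart at `x`, restricted to the preimage of a ball around the image of `x`. -/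
noncomputable def ballChart (x : X) : OpenPartialHomeomorph X E :=
  (chartAt E x).trans (.ofSet
    (Metric.ball (chartAt E x x) (exists_ball_subset_chartAt_target E x).choose) Metric.isOpen_ball)

variable (E) in
theorem ballChart_target (x : X) : (ballChart E x).target =
    Metric.ball (chartAt E x x) (exists_ball_subset_chartAt_target E x).choose := by
  simpa [ballChart] using (exists_ball_subset_chartAt_target E x).choose_spec.2

variable (E) in
theorem mem_ballChart_source (x : X) : x ∈ (ballChart E x).source := by
  simpa [ballChart] using (exists_ball_subset_chartAt_target E x).choose_spec.1

theorem ballChart_source_subset (x : X) : (ballChart E x).source ⊆ (chartAt E x).source := by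
  simp [ballChart]

theorem ballChart_target_subset (x : X) : (ballChart E x).target ⊆ (chartAt E x).target := by
  rw [ballChart_target]
  exact (exists_ball_subset_chartAt_target E x).choose_spec.2

theorem ballChart_coe (x : X) : ⇑(ballChart E x) = chartAt E x := rfl

namespace CircleCocycle

variable [NormedSpace ℝ E] (χ : CircleCocycle X)

theorem exists_primitive_ballChart (E : Type*) [NormedAddCommGroup E] [NormedSpace ℝ E]
    [ChartedSpace E X] (i : X) :
    ∃ h : X → Circle, h i = 1 ∧
      ∀ γ : C(I, X), (∀ t, γ t ∈ (ballChart E i).source) → h (γ 1) = h (γ 0) * χ.toFun γ :=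
  χ.exists_primitive (ballChart E i) (by rw [ballChart_target]; exact convex_ball _ _)
    (mem_ballChart_source E i)

variable (E) in
/-- A primitive of the cocycle on the domain of `ballChart E i`. -/
noncomputable def primitive (i : X) : X → Circle :=
  (χ.exists_primitive_ballChart E i).choose

variable (E) in
theorem primitive_self (i : X) : χ.primitive E i i = 1 :=
  (χ.exists_primitive_ballChart E i).choose_spec.1

theorem primitive_path (i : X) (γ : C(I, X)) (hγ : ∀ t, γ t ∈ (ballChart E i).source) :
    χ.primitive E i (γ 1) = χ.primitive E i (γ 0) * χ.toFun γ :=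
  (χ.exists_primitive_ballChart E i).choose_spec.2 γ hγ

/-- Along a short path both primitives are multiplied by the same cocycle value, which cancels in
the quotient. This is the flatness of the bundle. -/
theorem eventually_primitive_div_eq {i j x : X} (hi : x ∈ (ballChart E i).source)
    (hj : x ∈ (ballChart E j).source) :
    ∀ᶠ y in 𝓝 x, χ.primitive E i y / χ.primitive E j y =
      χ.primitive E i x / χ.primitive E j x := by
  have : LocallyPathConnectedSpace X := ChartedSpace.locallyPathConnectedSpace E X
  obtain ⟨V, ⟨hV, hVc⟩, hVs⟩ := (path_connected_basis x).mem_iff.1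
    (((ballChart E i).open_source.inter (ballChart E j).open_source).mem_nhds ⟨hi, hj⟩)
  filter_upwards [hV] with y hy
  obtain ⟨γ, hγ⟩ := hVc.joinedIn x (mem_of_mem_nhds hV) y hy
  have h1 := χ.primitive_path i γ.toContinuousMap fun t => (hVs (hγ t)).1
  have h2 := χ.primitive_path j γ.toContinuousMap fun t => (hVs (hγ t)).2
  simp only [Path.coe_toContinuousMap, γ.source, γ.target] at h1 h2
  rw [h1, h2, mul_div_mul_right_eq_div]

end CircleCocycle

end Primitives

/-! ### The flat ball bundle and its charts. -/

section BallBundle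

theorem mem_unitBall {n : ℕ} {w : EuclideanSpace ℂ (Fin n)} : w ∈ unitBall n ↔ ‖w‖ < 1 :=
  mem_ball_zero_iff

theorem unitBall_norm_lt_one {n : ℕ} (w : unitBall n) : ‖(w : EuclideanSpace ℂ (Fin n))‖ < 1 :=
  mem_unitBall.1 w.2

instance (n : ℕ) : Nonempty (unitBall n) := ⟨⟨0, by simp [mem_unitBall]⟩⟩

noncomputable instance (n : ℕ) : MulAction Circle (unitBall n) where
  smul c w := ⟨(c : ℂ) • w.1, by
    rw [mem_unitBall, norm_smul, Circle.norm_coe, one_mul]; exact unitBall_norm_lt_one w⟩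
  one_smul w := Subtype.ext (by
    change ((1 : Circle) : ℂ) • w.1 = w.1
    simp)
  mul_smul c d w := Subtype.ext (by
    change ((c * d : Circle) : ℂ) • w.1 = (c : ℂ) • ((d : ℂ) • w.1)
    simp [mul_smul])

instance (n : ℕ) : ContinuousSMul Circle (unitBall n) where
  continuous_smul := Continuous.subtype_mk
    ((continuous_subtype_val.comp continuous_fst).smul
      (continuous_subtype_val.comp continuous_snd)) _

namespace CircleCocycle

variable {X : Type*} [TopologicalSpace X] (χ : CircleCocycle X)
  (E : Type*) [NormedAddCommGroup E] [NormedSpace ℂ E] [ChartedSpace E X] (n : ℕ)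

/-- The flat bundle of unit balls with monodromy given by the cocycle. -/
noncomputable def ballBundleCore : FiberBundleCore X X (unitBall n) where
  baseSet i := (ballChart E i).source
  isOpen_baseSet i := (ballChart E i).open_source
  -- The fibre over `y` is read in the trivialization indexed by `y` itself, whose primitive is `1`
  -- at `y`; this removes one factor from every coordinate formula below.
  indexAt := id
  mem_baseSet_at := mem_ballChart_source E
  coordChange i j y w := (χ.primitive E i y / χ.primitive E j y) • w
  coordChange_self i y _ v := by rw [div_self', one_smul]
  coordChange_comp i j k y _ v := by rw [smul_smul, mul_comm, div_mul_div_cancel]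
  continuousOn_coordChange i j := by
    rintro ⟨x, v⟩ ⟨⟨hi, hj⟩, -⟩
    have h : (fun p : X × unitBall n =>
        (χ.primitive E i p.1 / χ.primitive E j p.1) • p.2) =ᶠ[𝓝 (x, v)]
        fun p => (χ.primitive E i x / χ.primitive E j x) • p.2 := by
      filter_upwards [continuousAt_fst.eventually (χ.eventually_primitive_div_eq hi hj)] with p hp
      rw [hp]
    exact (((continuous_const_smul _).comp continuous_snd).continuousAt.congr
      h.symm).continuousWithinAt

/-- The total space of the flat ball bundle. -/
abbrev BallBundle := (χ.ballBundleCore E n).TotalSpace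

variable {E n} in
/-- The ball coordinate of a point of the bundle. -/
def fiberCoord (z : χ.BallBundle E n) : unitBall n := z.2

variable {n} in
/-- The point of the bundle over `y` with ball coordinate `w`. -/
def bundleMk (y : X) (w : unitBall n) : χ.BallBundle E n := ⟨y, w⟩

theorem localTriv_apply (i : X) (z : χ.BallBundle E n) :
    (χ.ballBundleCore E n).localTriv i z =
      (z.1, (χ.primitive E i z.1)⁻¹ • χ.fiberCoord z) := by
  rw [FiberBundleCore.localTriv_apply]
  change (_, (χ.primitive E z.1 z.1 / χ.primitive E i z.1) • χ.fiberCoord z) = _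
  rw [χ.primitive_self E, one_div]

theorem localTriv_symm_apply (i y : X) (w : unitBall n) :
    ((χ.ballBundleCore E n).localTriv i).toOpenPartialHomeomorph.symm (y, w) =
      χ.bundleMk E y (χ.primitive E i y • w) := by
  rw [FiberBundleCore.localTriv_symm_apply]
  change χ.bundleMk E y ((χ.primitive E i y / χ.primitive E y y) • w) = _
  rw [χ.primitive_self E, div_one]

/-- The product chart of the ball bundle over `ballChart E i`. -/
noncomputable def bundleChart (i : X) :
    OpenPartialHomeomorph (χ.BallBundle E n) (E × EuclideanSpace ℂ (Fin n)) :=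
  ((χ.ballBundleCore E n).localTriv i).toOpenPartialHomeomorph.trans
    ((ballChart E i).prod ((unitBall n).openPartialHomeomorphSubtypeCoe inferInstance))

theorem mem_bundleChart_source {i : X} {z : χ.BallBundle E n} :
    z ∈ (χ.bundleChart E n i).source ↔ z.1 ∈ (ballChart E i).source := by
  simp only [bundleChart, OpenPartialHomeomorph.trans_source, OpenPartialHomeomorph.prod_source,
    TopologicalSpace.Opens.openPartialHomeomorphSubtypeCoe_source, Set.mem_inter_iff,
    Set.mem_preimage, Set.mem_prod, Set.mem_univ, and_true]
  exact and_self_iff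

theorem mem_bundleChart_target {i : X} {q : E × EuclideanSpace ℂ (Fin n)} :
    q ∈ (χ.bundleChart E n i).target ↔ q.1 ∈ (ballChart E i).target ∧ ‖q.2‖ < 1 := by
  simp only [bundleChart, OpenPartialHomeomorph.trans_target, OpenPartialHomeomorph.prod_target,
    TopologicalSpace.Opens.openPartialHomeomorphSubtypeCoe_target, Set.mem_inter_iff,
    Set.mem_preimage, Set.mem_prod]
  constructor
  · exact fun h => ⟨h.1.1, mem_unitBall.1 h.1.2⟩
  · exact fun h => ⟨⟨h.1, mem_unitBall.2 h.2⟩, (Bundle.Trivialization.mem_target _).2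
      ((ballChart E i).map_target h.1)⟩

theorem bundleChart_apply (i : X) (z : χ.BallBundle E n) :
    χ.bundleChart E n i z =
      (chartAt E i z.1, (((χ.primitive E i z.1)⁻¹ : Circle) : ℂ) • (χ.fiberCoord z).1) := by
  change ((ballChart E i).prod ((unitBall n).openPartialHomeomorphSubtypeCoe inferInstance))
    ((χ.ballBundleCore E n).localTriv i z) = _
  rw [localTriv_apply]
  rfl

theorem bundleChart_symm_apply {i : X} {a : E} (w : unitBall n) :
    (χ.bundleChart E n i).symm (a, w) =
      χ.bundleMk E ((chartAt E i).symm a) (χ.primitive E i ((chartAt E i).symm a) • w) := by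
  change ((χ.ballBundleCore E n).localTriv i).toOpenPartialHomeomorph.symm
    ((chartAt E i).symm a, ((unitBall n).openPartialHomeomorphSubtypeCoe inferInstance).symm w) = _
  rw [← localTriv_symm_apply]
  congr 2
  exact ((unitBall n).openPartialHomeomorphSubtypeCoe inferInstance).left_inv (Set.mem_univ _)

noncomputable instance : ChartedSpace (E × EuclideanSpace ℂ (Fin n)) (χ.BallBundle E n) where
  atlas := Set.range (χ.bundleChart E n)
  chartAt z := χ.bundleChart E n z.1
  mem_chart_source z := (χ.mem_bundleChart_source E n).2 (mem_ballChart_source E z.1)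
  chart_mem_atlas _ := Set.mem_range_self _

instance [T2Space X] : T2Space (χ.BallBundle E n) where
  t2 z z' hne := by
    by_cases h : z.1 = z'.1
    · have hz : z ∈ (χ.bundleChart E n z.1).source :=
        (χ.mem_bundleChart_source E n).2 (mem_ballChart_source E z.1)
      have hz' : z' ∈ (χ.bundleChart E n z.1).source :=
        (χ.mem_bundleChart_source E n).2 (h ▸ mem_ballChart_source E z.1)
      obtain ⟨u, v, hu, hv, hzu, hzv, huv⟩ :=
        t2_separation ((χ.bundleChart E n z.1).injOn.ne hz hz' hne)
      exact ⟨_, _, (χ.bundleChart E n z.1).isOpen_inter_preimage hu,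
        (χ.bundleChart E n z.1).isOpen_inter_preimage hv, ⟨hz, hzu⟩, ⟨hz', hzv⟩,
        (huv.preimage _).mono Set.inter_subset_right Set.inter_subset_right⟩
    · obtain ⟨u, v, hu, hv, hzu, hzv, huv⟩ := t2_separation h
      have hc := (χ.ballBundleCore E n).continuous_proj
      exact ⟨_, _, hu.preimage hc, hv.preimage hc, hzu, hzv, huv.preimage _⟩

end CircleCocycle

end BallBundle

/-! ### Complex structure and flatness of the total space. -/

section BundleManifold

theorem contDiffOn_chartAt_symm (E : Type*) [NormedAddCommGroup E] [NormedSpace ℂ E]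
    {X : Type*} [TopologicalSpace X] [ChartedSpace E X] [IsManifold 𝓘(ℂ, E) ω X] (i j : X) :
    ContDiffOn ℂ ω (chartAt E j ∘ (chartAt E i).symm)
      ((chartAt E i).symm ≫ₕ chartAt E j).source := by
  have h := (contDiffGroupoid ω 𝓘(ℂ, E)).compatible (chart_mem_atlas E i) (chart_mem_atlas E j)
  have := (mem_groupoid_of_pregroupoid.1 h).1
  simpa [contDiffPregroupoid] using this

namespace CircleCocycle

variable {X : Type*} [TopologicalSpace X] (χ : CircleCocycle X)
  (E : Type*) [NormedAddCommGroup E] [NormedSpace ℂ E] [ChartedSpace E X] (n : ℕ)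

theorem bundleChart_bundleChart_symm {i j : X} {q : E × EuclideanSpace ℂ (Fin n)} (hq : ‖q.2‖ < 1) :
    χ.bundleChart E n j ((χ.bundleChart E n i).symm q) =
      (chartAt E j ((chartAt E i).symm q.1), ((χ.primitive E i ((chartAt E i).symm q.1) /
        χ.primitive E j ((chartAt E i).symm q.1) : Circle) : ℂ) • q.2) := by
  have h := χ.bundleChart_symm_apply E n (i := i) (a := q.1) ⟨q.2, mem_unitBall.2 hq⟩
  rw [show (χ.bundleChart E n i).symm q = _ from h, bundleChart_apply]
  change (_, _ • ((χ.primitive E i ((chartAt E i).symm q.1) : Circle) : ℂ) • q.2) = _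
  rw [smul_smul, ← Circle.coe_mul, mul_comm, ← div_eq_mul_inv]
  rfl

instance [IsManifold 𝓘(ℂ, E) ω X] :
    IsManifold 𝓘(ℂ, E × EuclideanSpace ℂ (Fin n)) ω (χ.BallBundle E n) := by
  apply isManifold_of_contDiffOn
  rintro _ _ ⟨i, rfl⟩ ⟨j, rfl⟩ q hq
  simp only [modelWithCornersSelf_coe_symm, Set.preimage_id_eq, id_eq, modelWithCornersSelf_coe,
    Set.range_id, Set.inter_univ, OpenPartialHomeomorph.trans_source,
    OpenPartialHomeomorph.symm_source] at hq
  obtain ⟨hq1, hq2⟩ := hq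
  obtain ⟨hqi, hqn⟩ := (χ.mem_bundleChart_target E n).1 hq1
  have hyi : (chartAt E i).symm q.1 ∈ (ballChart E i).source := (ballChart E i).map_target hqi
  have hyj : (chartAt E i).symm q.1 ∈ (ballChart E j).source := by
    have := (χ.mem_bundleChart_source E n).1 hq2
    rwa [show (χ.bundleChart E n i).symm q = _ from
      χ.bundleChart_symm_apply E n (i := i) (a := q.1) ⟨q.2, mem_unitBall.2 hqn⟩] at this
  set c := ((χ.primitive E i ((chartAt E i).symm q.1) /
    χ.primitive E j ((chartAt E i).symm q.1) : Circle) : ℂ)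
  have hct : q.1 ∈ (chartAt E i).target := ballChart_target_subset i hqi
  -- Near `q` the scalar is frozen at `c`, so the transition is a base transition times a fixed
  -- linear map.
  have hev : (χ.bundleChart E n j ∘ (χ.bundleChart E n i).symm) =ᶠ[𝓝 q]
      fun q' => ((chartAt E j ∘ (chartAt E i).symm) q'.1, c • q'.2) := by
    have h1 : ∀ᶠ q' : E × EuclideanSpace ℂ (Fin n) in 𝓝 q, ‖q'.2‖ < 1 :=
      (continuous_snd.norm.isOpen_preimage _ isOpen_Iio).mem_nhds hqn
    have h2 := (((chartAt E i).continuousAt_symm hct).comp continuousAt_fst).eventually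
      (χ.eventually_primitive_div_eq hyi hyj)
    filter_upwards [h1, h2] with q' h1 h2
    simp only [Function.comp_apply] at h2 ⊢
    rw [bundleChart_bundleChart_symm χ E n h1, h2]
  refine ContDiffAt.contDiffWithinAt (ContDiffAt.congr_of_eventuallyEq ?_ hev)
  refine ContDiffAt.prodMk ?_ (contDiffAt_snd.const_smul c)
  refine ContDiffAt.comp (g := chartAt E j ∘ (chartAt E i).symm) q
    ((contDiffOn_chartAt_symm E i j).contDiffAt
      (((chartAt E i).symm ≫ₕ chartAt E j).open_source.mem_nhds ?_)) contDiffAt_fst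
  exact ⟨hct, ballChart_source_subset j hyj⟩

/-- Read in `bundleChart` and in the product chart `Φ`, the trivialization is the identity. The maps
`h1` and `h2` only pass between the two model structures on the product. -/
theorem mdifferentiable_localTriv [IsManifold 𝓘(ℂ, E) ω X] (i : X) :
    ((χ.ballBundleCore E n).localTriv i).toOpenPartialHomeomorph.MDifferentiable
      𝓘(ℂ, E × EuclideanSpace ℂ (Fin n)) (𝓘(ℂ, E).prod 𝓘(ℂ, EuclideanSpace ℂ (Fin n))) := by
  have : IsManifold 𝓘(ℂ, E × EuclideanSpace ℂ (Fin n)) 1 (χ.BallBundle E n) :=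
    IsManifold.of_le (n := ω) le_top
  have : IsManifold 𝓘(ℂ, E) 1 X := IsManifold.of_le (n := ω) le_top
  have hB : χ.bundleChart E n i ∈ atlas (E × EuclideanSpace ℂ (Fin n)) (χ.BallBundle E n) :=
    Set.mem_range_self i
  obtain ⟨w⟩ : Nonempty (unitBall n) := inferInstance
  let Φ := chartAt (ModelProd E (EuclideanSpace ℂ (Fin n))) (i, w)
  have hΦ : Φ.MDifferentiable (𝓘(ℂ, E).prod 𝓘(ℂ, EuclideanSpace ℂ (Fin n)))
      (𝓘(ℂ, E).prod 𝓘(ℂ, EuclideanSpace ℂ (Fin n))) := mdifferentiable_chart (i, w)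
  have h1 : MDifferentiable (M' := ModelProd E (EuclideanSpace ℂ (Fin n)))
      𝓘(ℂ, E × EuclideanSpace ℂ (Fin n)) (𝓘(ℂ, E).prod 𝓘(ℂ, EuclideanSpace ℂ (Fin n)))
      (fun q : E × EuclideanSpace ℂ (Fin n) => (q.1, q.2)) := by
    have hf : MDifferentiable 𝓘(ℂ, E × EuclideanSpace ℂ (Fin n)) 𝓘(ℂ, E)
      (fun q : E × EuclideanSpace ℂ (Fin n) => q.1) := differentiable_fst.mdifferentiable
    have hs : MDifferentiable 𝓘(ℂ, E × EuclideanSpace ℂ (Fin n)) 𝓘(ℂ, EuclideanSpace ℂ (Fin n))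
      (fun q : E × EuclideanSpace ℂ (Fin n) => q.2) := differentiable_snd.mdifferentiable
    have := hf.prodMk hs
    rwa [chartedSpaceSelf_prod] at this
  have h2 : MDifferentiable (M' := E × EuclideanSpace ℂ (Fin n))
      (𝓘(ℂ, E).prod 𝓘(ℂ, EuclideanSpace ℂ (Fin n))) 𝓘(ℂ, E × EuclideanSpace ℂ (Fin n))
      (fun q : ModelProd E (EuclideanSpace ℂ (Fin n)) => (q.1, q.2)) := by
    have := (mdifferentiable_fst (I := 𝓘(ℂ, E)) (I' := 𝓘(ℂ, EuclideanSpace ℂ (Fin n)))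
      (M := E) (M' := EuclideanSpace ℂ (Fin n))).prodMk_space mdifferentiable_snd
    rwa [chartedSpaceSelf_prod] at this
  have hΦ1 (y : X) (v : unitBall n) : Φ (y, v) = (chartAt E i y, v.1) := rfl
  have hΦs (y : X) (v : unitBall n) (hy : y ∈ (ballChart E i).source) : (y, v) ∈ Φ.source := by
    refine ⟨ballChart_source_subset i hy, ?_⟩
    change v ∈ ((chartAt (EuclideanSpace ℂ (Fin n)) w.1).subtypeRestr ⟨w⟩).source
    rw [OpenPartialHomeomorph.subtypeRestr_source]
    trivial
  have hloc (z : χ.BallBundle E n) (hz : z.1 ∈ (ballChart E i).source) :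
      ((χ.bundleChart E n i z).1, (χ.bundleChart E n i z).2) =
        Φ ((χ.ballBundleCore E n).localTriv i z) := by
    rw [localTriv_apply, bundleChart_apply, hΦ1]
    rfl
  have hmem (z : χ.BallBundle E n) (hz : z.1 ∈ (ballChart E i).source) :
      (χ.ballBundleCore E n).localTriv i z ∈ Φ.source := by
    rw [localTriv_apply]
    exact hΦs _ _ hz
  have hsource (z : χ.BallBundle E n)
      (hz : z ∈ ((χ.ballBundleCore E n).localTriv i).toOpenPartialHomeomorph.source) :
      z.1 ∈ (ballChart E i).source := hz
  constructor
  · have h3 : MDifferentiableOn 𝓘(ℂ, E × EuclideanSpace ℂ (Fin n))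
        (𝓘(ℂ, E).prod 𝓘(ℂ, EuclideanSpace ℂ (Fin n)))
        (fun z => Φ.symm ((χ.bundleChart E n i z).1, (χ.bundleChart E n i z).2))
        ((χ.ballBundleCore E n).localTriv i).toOpenPartialHomeomorph.source := by
      refine hΦ.2.comp (h1.comp_mdifferentiableOn ((mdifferentiableOn_atlas hB).mono fun z hz =>
        (χ.mem_bundleChart_source E n).2 (hsource z hz))) fun z hz => ?_
      change ((χ.bundleChart E n i z).1, (χ.bundleChart E n i z).2) ∈ Φ.target
      rw [hloc z (hsource z hz)]
      exact Φ.map_source (hmem z (hsource z hz))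
    refine h3.congr fun z hz => ?_
    rw [hloc z (hsource z hz), Φ.left_inv (hmem z (hsource z hz))]
    rfl
  · have hy (p : X × unitBall n)
        (hp : p ∈ ((χ.ballBundleCore E n).localTriv i).toOpenPartialHomeomorph.target) :
        p.1 ∈ (ballChart E i).source := ((χ.ballBundleCore E n).localTriv i).mem_target.1 hp
    have h3 : MDifferentiableOn (𝓘(ℂ, E).prod 𝓘(ℂ, EuclideanSpace ℂ (Fin n)))
        𝓘(ℂ, E × EuclideanSpace ℂ (Fin n))
        (fun p => (χ.bundleChart E n i).symm ((Φ p).1, (Φ p).2))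
        ((χ.ballBundleCore E n).localTriv i).toOpenPartialHomeomorph.target := by
      refine (mdifferentiableOn_atlas_symm hB).comp (h2.comp_mdifferentiableOn
        (hΦ.1.mono fun p hp => hΦs _ _ (hy p hp))) fun p hp => ?_
      exact (χ.mem_bundleChart_target E n).2
        ⟨(ballChart E i).map_source (hy p hp), unitBall_norm_lt_one p.2⟩
    refine h3.congr fun p hp => ?_
    obtain ⟨y, v⟩ := p
    rw [hΦ1]
    refine (χ.localTriv_symm_apply E n i y v).trans ?_
    refine Eq.trans ?_ (χ.bundleChart_symm_apply E n (i := i) (a := chartAt E i y) v).symm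
    rw [(chartAt E i).left_inv (ballChart_source_subset i (hy _ hp))]

theorem isFlatBundle_proj [IsManifold 𝓘(ℂ, E) ω X] :
    IsFlatBundle 𝓘(ℂ, E) 𝓘(ℂ, EuclideanSpace ℂ (Fin n)) 𝓘(ℂ, E × EuclideanSpace ℂ (Fin n))
      (unitBall n) (χ.ballBundleCore E n).proj := by
  refine ⟨Set.range (χ.ballBundleCore E n).localTriv,
    fun x => ⟨_, Set.mem_range_self x, mem_ballChart_source E x⟩, ?_, ?_⟩
  · rintro _ ⟨i, rfl⟩
    exact χ.mdifferentiable_localTriv E n i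
  · rintro _ ⟨i, rfl⟩ _ ⟨j, rfl⟩ x ⟨hi, hj⟩
    have hc (y : X) (hy : y ∈ (ballChart E i).source) (v : unitBall n) :
        ((χ.ballBundleCore E n).localTriv i).coordChange ((χ.ballBundleCore E n).localTriv j) y v =
          (χ.primitive E i y / χ.primitive E j y) • v := by
      have : ((χ.ballBundleCore E n).localTriv i).coordChange
        ((χ.ballBundleCore E n).localTriv j) y v =
        ((χ.ballBundleCore E n).localTriv j
          (((χ.ballBundleCore E n).localTriv i).toOpenPartialHomeomorph.symm (y, v))).2 := rfl
      rw [this, localTriv_symm_apply, localTriv_apply]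
      change _ • _ • v = _
      rw [smul_smul, mul_comm, ← div_eq_mul_inv]
      rfl
    filter_upwards [χ.eventually_primitive_div_eq hi hj,
      (ballChart E i).open_source.mem_nhds hi] with y hy hyi v
    rw [hc y hyi, hc x hi, hy]

end CircleCocycle

end BundleManifold

/-! ### Plurisubharmonicity and complex Hessian of a squared norm. -/

section NormSq

open InnerProductSpace

variable {V : Type*} [NormedAddCommGroup V] [NormedSpace ℂ V]
  {F : Type*} [NormedAddCommGroup F] [InnerProductSpace ℂ F] (L : V →L[ℂ] F)

theorem contDiff_norm_sq_clm : ContDiff ℝ ω fun x : V => ‖L x‖ ^ 2 :=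
  ContDiff.norm_sq ℂ (L.restrictScalars ℝ).contDiff

/-- Expanding the square gives the real part of the holomorphic `g`, whose mean is `‖L a‖ ^ 2`, plus
the nonnegative term `‖ζ • L b‖ ^ 2`. -/
theorem norm_sq_le_circleAverage (a b : V) :
    ‖L a‖ ^ 2 ≤ Real.circleAverage (fun ζ : ℂ => ‖L (a + ζ • b)‖ ^ 2) 0 1 := by
  set g : ℂ → ℂ := fun ζ => (‖L a‖ : ℂ) ^ 2 + 2 * (ζ * inner ℂ (L a) (L b)) with hg
  have hgd : Differentiable ℂ g := by fun_prop
  have hgi : CircleIntegrable g 0 1 := hgd.continuous.continuousOn.circleIntegrable zero_le_one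
  have h1 : Real.circleAverage g 0 1 = g 0 := hgd.diffContOnCl.circleAverage
  have h2 : Real.circleAverage (fun ζ => (g ζ).re) 0 1 = ‖L a‖ ^ 2 := by
    have := Complex.reCLM.circleAverage_comp_comm hgi
    rw [h1] at this
    refine this.trans ?_
    simp [hg, ← Complex.ofReal_pow]
  rw [← h2]
  refine Real.circleAverage_mono
    ((Complex.continuous_re.comp hgd.continuous).continuousOn.circleIntegrable zero_le_one)
    (Continuous.continuousOn (by fun_prop)).circleIntegrable' fun ζ _ => ?_
  rw [map_add, map_smul, @norm_add_sq ℂ, inner_smul_right]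
  have hre : (g ζ).re = ‖L a‖ ^ 2 + 2 * (ζ * inner ℂ (L a) (L b)).re := by
    simp [hg, ← Complex.ofReal_pow]
  rw [hre, RCLike.re_to_complex]
  exact le_add_of_nonneg_right (by positivity)

theorem plurisubharmonicOn_norm_sq {u : V → ℝ} {U : Set V} (hu : ∀ x ∈ U, u x = ‖L x‖ ^ 2) :
    PlurisubharmonicOn u U := by
  have hc : Continuous fun x => ‖L x‖ ^ 2 := by fun_prop
  refine ⟨(hc.continuousOn.congr hu).upperSemicontinuousOn, fun a b hab => ?_⟩
  have hs (ζ : ℂ) (hζ : ζ ∈ Metric.sphere (0 : ℂ) |1|) :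
      u (a + ζ • b) = ‖L (a + ζ • b)‖ ^ 2 := by
    refine hu _ (hab ζ ?_)
    simpa using (mem_sphere_zero_iff_norm.1 hζ).le
  have hci : CircleIntegrable (fun ζ : ℂ => ‖L (a + ζ • b)‖ ^ 2) 0 1 :=
    (Continuous.continuousOn (by fun_prop)).circleIntegrable'
  refine ⟨hci.congr fun θ _ => (hs (circleMap 0 1 θ) (by simp)).symm, ?_⟩
  rw [Real.circleAverage_congr_sphere hs, hu a (by simpa using hab 0)]
  exact norm_sq_le_circleAverage L a b

/-- The inner product is conjugate-linear in its first slot, so the conjugate derivative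
differentiates only that slot. -/
theorem wirtingerDerivBar_norm_sq (v x : V) :
    wirtingerDerivBar v (fun y => ((‖L y‖ ^ 2 : ℝ) : ℂ)) x = inner ℂ (L v) (L x) := by
  have hfun : (fun y => ((‖L y‖ ^ 2 : ℝ) : ℂ)) = fun y => inner ℂ (L y) (L y) := by
    ext y
    rw [inner_self_eq_norm_sq_to_K]
    simp
  have hL : HasFDerivAt (𝕜 := ℝ) L (L.restrictScalars ℝ) x := (L.restrictScalars ℝ).hasFDerivAt
  have key (w : V) : fderiv ℝ (fun y => inner ℂ (L y) (L y)) x w =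
      inner ℂ (L x) (L w) + inner ℂ (L w) (L x) := by
    rw [fderiv_inner_apply ℂ hL.differentiableAt hL.differentiableAt, hL.fderiv]
    rfl
  rw [wirtingerDerivBar, hfun, key, key, map_smul, inner_smul_left, inner_smul_right]
  simp only [Complex.conj_I]
  linear_combination (1 / 2) * (inner ℂ (L x) (L v) - inner ℂ (L v) (L x)) * Complex.I_mul_I

theorem wirtingerDeriv_inner (w : F) (v x : V) :
    wirtingerDeriv v (fun y => inner ℂ w (L y)) x = inner ℂ w (L v) := by
  have hL : HasFDerivAt (𝕜 := ℝ) (fun y => inner ℂ w (L y))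
      (((innerSL ℂ w).comp L).restrictScalars ℝ) x :=
    (((innerSL ℂ w).comp L).restrictScalars ℝ).hasFDerivAt
  rw [wirtingerDeriv, hL.fderiv]
  change 1 / 2 * (inner ℂ w (L v) - Complex.I * inner ℂ w (L (Complex.I • v))) = _
  rw [map_smul, inner_smul_right]
  linear_combination (-1 / 2) * inner ℂ w (L v) * Complex.I_mul_I

theorem complexHessian_norm_sq {ι : Type*} (b : Module.Basis ι ℂ V) {u : V → ℝ} {x : V}
    (hu : u =ᶠ[𝓝 x] fun y => ‖L y‖ ^ 2) :
    complexHessian b u x = Matrix.of fun j k => inner ℂ (L (b k)) (L (b j)) := by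
  ext j k
  have h1 : (wirtingerDerivBar (b k) fun y => (u y : ℂ)) =ᶠ[𝓝 x]
      fun y => inner ℂ (L (b k)) (L y) := by
    filter_upwards [hu.eventually_nhds] with y hy
    have hy' : (fun z => (u z : ℂ)) =ᶠ[𝓝 y] fun z => ((‖L z‖ ^ 2 : ℝ) : ℂ) :=
      hy.mono fun z hz => congrArg _ hz
    rw [← wirtingerDerivBar_norm_sq, wirtingerDerivBar, wirtingerDerivBar, hy'.fderiv_eq]
  rw [Matrix.of_apply, ← wirtingerDeriv_inner L (L (b k)) (b j) x, complexHessian, Matrix.of_apply,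
    wirtingerDeriv, wirtingerDeriv, h1.fderiv_eq]

open scoped ComplexOrder in
theorem Matrix.card_pos_eigenvalues_diagonal_sumElim (m n : ℕ)
    (h : (Matrix.diagonal (Sum.elim 0 1 : Fin m ⊕ Fin n → ℂ)).IsHermitian) :
    Nat.card {i // 0 < h.eigenvalues i} = n := by
  have hpos : (Matrix.diagonal (Sum.elim 0 1 : Fin m ⊕ Fin n → ℂ)).PosSemidef := by
    rw [Matrix.posSemidef_diagonal_iff]
    rintro (i | i) <;> simp
  have h1 := h.rank_eq_card_non_zero_eigs
  rw [Matrix.rank_diagonal, ← Nat.card_eq_fintype_card, ← Nat.card_eq_fintype_card] at h1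
  have h2 : Nat.card {i // 0 < h.eigenvalues i} = Nat.card {i // h.eigenvalues i ≠ 0} :=
    Nat.card_congr (Equiv.subtypeEquivRight fun i => (hpos.eigenvalues_nonneg i).lt_iff_ne')
  rw [h2, ← h1, Nat.card_eq_fintype_card, Fintype.card_subtype, Finset.card_filter]
  simp

theorem complexHessian_norm_sq_snd {m n : ℕ}
    {u : EuclideanSpace ℂ (Fin m) × EuclideanSpace ℂ (Fin n) → ℝ} {x}
    (hu : u =ᶠ[𝓝 x] fun y => ‖y.2‖ ^ 2) :
    complexHessian (stdBasisProd m n) u x = Matrix.diagonal (Sum.elim 0 1) := by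
  rw [complexHessian_norm_sq (ContinuousLinearMap.snd ℂ _ _) _ hu]
  ext (j | j) (k | k) <;>
    simp [stdBasisProd, Matrix.diagonal_apply, EuclideanSpace.inner_single_left, eq_comm]

end NormSq

/-! ### The exhaustion function. -/

section Exhaustion

namespace CircleCocycle

variable {X : Type*} [TopologicalSpace X] (χ : CircleCocycle X)
  (E : Type*) [NormedAddCommGroup E] [NormedSpace ℂ E] [ChartedSpace E X] (n : ℕ)

variable {E n} in
/-- The squared norm of the fibre coordinate. -/
noncomputable def fiberNormSq (z : χ.BallBundle E n) : ℝ :=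
  ‖(χ.fiberCoord z : EuclideanSpace ℂ (Fin n))‖ ^ 2

theorem fiberNormSq_eq (i : X) (z : χ.BallBundle E n) :
    χ.fiberNormSq z = ‖(χ.bundleChart E n i z).2‖ ^ 2 := by
  rw [bundleChart_apply, norm_smul, Circle.norm_coe, one_mul]
  rfl

theorem fiberNormSq_bundleChart_symm {i : X} {q : E × EuclideanSpace ℂ (Fin n)}
    (hq : q ∈ (χ.bundleChart E n i).target) :
    χ.fiberNormSq ((χ.bundleChart E n i).symm q) = ‖q.2‖ ^ 2 := by
  rw [fiberNormSq_eq χ E n i, (χ.bundleChart E n i).right_inv hq]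

variable {E n} in
theorem fiberNormSq_lt_one (z : χ.BallBundle E n) : χ.fiberNormSq z < 1 :=
  pow_lt_one₀ (norm_nonneg _) (unitBall_norm_lt_one _) two_ne_zero

theorem fiberNormSq_comp_eventuallyEq {i : X} {q : E × EuclideanSpace ℂ (Fin n)}
    (hq : q ∈ (χ.bundleChart E n i).target) :
    χ.fiberNormSq ∘ (χ.bundleChart E n i).symm =ᶠ[𝓝 q] fun q => ‖q.2‖ ^ 2 := by
  filter_upwards [(χ.bundleChart E n i).open_target.mem_nhds hq] with q' hq'
  exact χ.fiberNormSq_bundleChart_symm E n hq'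

theorem continuous_fiberNormSq : Continuous (χ.fiberNormSq : χ.BallBundle E n → ℝ) := by
  refine continuous_iff_continuousAt.2 fun z => ?_
  rw [show χ.fiberNormSq = fun z' : χ.BallBundle E n => ‖(χ.bundleChart E n z.1 z').2‖ ^ 2 from
    funext (χ.fiberNormSq_eq E n z.1)]
  exact (((χ.bundleChart E n z.1).continuousAt ((χ.mem_bundleChart_source E n).2
    (mem_ballChart_source E z.1))).snd.norm).pow 2

theorem isRealAnalytic_fiberNormSq :
    IsRealAnalytic (E × EuclideanSpace ℂ (Fin n)) (χ.fiberNormSq : χ.BallBundle E n → ℝ) := by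
  intro z
  refine contMDiffAt_iff.2 ⟨(χ.continuous_fiberNormSq E n).continuousAt, ?_⟩
  have hz : χ.bundleChart E n z.1 z ∈ (χ.bundleChart E n z.1).target :=
    (χ.bundleChart E n z.1).map_source ((χ.mem_bundleChart_source E n).2
      (mem_ballChart_source E z.1))
  exact ((contDiff_norm_sq_clm (ContinuousLinearMap.snd ℂ E
    (EuclideanSpace ℂ (Fin n)))).contDiffAt.congr_of_eventuallyEq
      (χ.fiberNormSq_comp_eventuallyEq E n hz)).contDiffWithinAt

theorem isPlurisubharmonic_fiberNormSq :
    IsPlurisubharmonic (E × EuclideanSpace ℂ (Fin n)) (χ.fiberNormSq : χ.BallBundle E n → ℝ) := by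
  rintro _ ⟨i, rfl⟩
  exact plurisubharmonicOn_norm_sq (ContinuousLinearMap.snd ℂ E (EuclideanSpace ℂ (Fin n)))
    fun q hq => χ.fiberNormSq_bundleChart_symm E n hq

/-- Finitely many compact sets inside trivializing charts cover `X`; over each, the sublevel set is
a product with a closed ball, compact in the open unit ball because `t < 1`. -/
theorem isCompact_fiberNormSq_le [CompactSpace X] [T2Space X] {t : ℝ} (ht : t < 1) :
    IsCompact {z : χ.BallBundle E n | χ.fiberNormSq z ≤ t} := by
  have hK (x : X) : ∃ K ∈ 𝓝 x, K ⊆ (ballChart E x).source ∧ IsCompact K :=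
    local_compact_nhds ((ballChart E x).open_source.mem_nhds (mem_ballChart_source E x))
  choose K hKn hKs hKc using hK
  obtain ⟨s, -, hs⟩ := isCompact_univ.elim_nhds_subcover K fun x _ => hKn x
  have hB : IsCompact {w : unitBall n | ‖w.1‖ ^ 2 ≤ t} := by
    rw [Topology.IsEmbedding.subtypeVal.isCompact_iff]
    have : Subtype.val '' {w : unitBall n | ‖w.1‖ ^ 2 ≤ t} =
        {w : EuclideanSpace ℂ (Fin n) | ‖w‖ ^ 2 ≤ t} := by
      ext w
      constructor
      · rintro ⟨w, hw, rfl⟩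
        exact hw
      · intro hw
        exact ⟨⟨w, mem_unitBall.2 ((sq_lt_one_iff₀ (norm_nonneg _)).1 (lt_of_le_of_lt hw ht))⟩,
          hw, rfl⟩
    rw [this]
    refine Metric.isCompact_of_isClosed_isBounded
      (isClosed_le (continuous_norm.pow 2) continuous_const) ?_
    refine Metric.isBounded_closedBall (x := (0 : EuclideanSpace ℂ (Fin n))) (r := 1) |>.subset
      fun w hw => mem_closedBall_zero_iff.2 ?_
    exact ((sq_lt_one_iff₀ (norm_nonneg _)).1 (lt_of_le_of_lt hw ht)).le
  have hsub (x : X) : K x ×ˢ {w : unitBall n | ‖w.1‖ ^ 2 ≤ t} ⊆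
      ((χ.ballBundleCore E n).localTriv x).toOpenPartialHomeomorph.target :=
    fun p hp => ((χ.ballBundleCore E n).localTriv x).mem_target.2 (hKs x hp.1)
  have himg : {z : χ.BallBundle E n | χ.fiberNormSq z ≤ t} =
      ⋃ x ∈ s, ((χ.ballBundleCore E n).localTriv x).toOpenPartialHomeomorph.symm ''
        (K x ×ˢ {w : unitBall n | ‖w.1‖ ^ 2 ≤ t}) := by
    ext z
    simp only [Set.mem_iUnion, exists_prop]
    constructor
    · intro hz
      obtain ⟨x, hx, hzx⟩ := Set.mem_iUnion₂.1 (hs (Set.mem_univ z.1))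
      refine ⟨x, hx, (χ.ballBundleCore E n).localTriv x z, ?_,
        ((χ.ballBundleCore E n).localTriv x).toOpenPartialHomeomorph.left_inv (hKs x hzx)⟩
      rw [localTriv_apply]
      refine ⟨hzx, ?_⟩
      change ‖((_ : Circle) : ℂ) • (χ.fiberCoord z).1‖ ^ 2 ≤ t
      rw [norm_smul, Circle.norm_coe, one_mul]
      exact hz
    · rintro ⟨x, hx, ⟨y, w⟩, ⟨hy, hw⟩, rfl⟩
      rw [localTriv_symm_apply]
      change ‖((_ : Circle) : ℂ) • w.1‖ ^ 2 ≤ t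
      rw [norm_smul, Circle.norm_coe, one_mul]
      exact hw
  rw [himg]
  exact s.isCompact_biUnion fun x _ => ((hKc x).prod hB).image_of_continuousOn
    (((χ.ballBundleCore E n).localTriv x).toOpenPartialHomeomorph.continuousOn_symm.mono (hsub x))

theorem isBoundedExhaustion_fiberNormSq [CompactSpace X] [T2Space X] :
    IsBoundedExhaustion (χ.fiberNormSq : χ.BallBundle E n → ℝ) := by
  refine ⟨(Metric.isBounded_Icc 0 1).subset ?_, 1, χ.fiberNormSq_lt_one,
    fun t ht => χ.isCompact_fiberNormSq_le E n ht⟩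
  rintro _ ⟨z, rfl⟩
  exact ⟨sq_nonneg _, (χ.fiberNormSq_lt_one z).le⟩

theorem secondCountable_ballBundle [CompactSpace X] [T2Space X] [SecondCountableTopology E] :
    SecondCountableTopology (χ.BallBundle E n) := by
  have : SigmaCompactSpace (χ.BallBundle E n) := by
    refine ⟨fun k : ℕ => {z | χ.fiberNormSq z ≤ 1 - 1 / ((k : ℝ) + 1)},
      fun k => χ.isCompact_fiberNormSq_le E n (by simpa using by positivity), ?_⟩
    refine Set.eq_univ_of_forall fun z => Set.mem_iUnion.2 ?_
    obtain ⟨k, hk⟩ := exists_nat_one_div_lt (sub_pos.2 (χ.fiberNormSq_lt_one z))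
    exact ⟨k, by rw [Set.mem_ofPred_eq]; linarith⟩
  exact ChartedSpace.secondCountable_of_sigmaCompact (E × EuclideanSpace ℂ (Fin n)) _

theorem hessianHasPositiveEigenvalues_fiberNormSq {m : ℕ}
    [ChartedSpace (EuclideanSpace ℂ (Fin m)) X] :
    HessianHasPositiveEigenvalues (stdBasisProd m n) n
      (χ.fiberNormSq : χ.BallBundle (EuclideanSpace ℂ (Fin m)) n → ℝ) := by
  rintro _ ⟨i, rfl⟩ q hq
  rw [complexHessian_norm_sq_snd (χ.fiberNormSq_comp_eventuallyEq _ n hq)]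
  have h : (Matrix.diagonal (Sum.elim 0 1 : Fin m ⊕ Fin n → ℂ)).IsHermitian := by
    rw [Matrix.isHermitian_diagonal_iff]
    rintro (i | i) <;> simp [IsSelfAdjoint]
  exact ⟨h, Matrix.card_pos_eigenvalues_diagonal_sumElim m n h⟩

end CircleCocycle

end Exhaustion

/-! ### Holomorphic functions are constant. -/

section Holomorphic
open unitInterval

namespace CircleCocycle

variable {X : Type*} [TopologicalSpace X] {χ : CircleCocycle X}
  {E : Type*} [NormedAddCommGroup E] [NormedSpace ℂ E] [ChartedSpace E X] {n : ℕ}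
  {f : χ.BallBundle E n → ℂ}

theorem differentiableOn_comp_bundleChart_symm [IsManifold 𝓘(ℂ, E) ω X]
    (hf : MDifferentiable 𝓘(ℂ, E × EuclideanSpace ℂ (Fin n)) 𝓘(ℂ, ℂ) f) (i : X) :
    DifferentiableOn ℂ (f ∘ (χ.bundleChart E n i).symm) (χ.bundleChart E n i).target := by
  have : IsManifold 𝓘(ℂ, E × EuclideanSpace ℂ (Fin n)) 1 (χ.BallBundle E n) :=
    IsManifold.of_le (n := ω) le_top
  exact mdifferentiableOn_iff_differentiableOn.1
    (hf.comp_mdifferentiableOn (mdifferentiableOn_atlas_symm (Set.mem_range_self i)))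

/-- Over a ball chart the flat leaf `y ↦ χ.primitive E i y * c` has constant second coordinate, so
`f` restricts to a holomorphic function of the base coordinate, and the maximum modulus principle
applies. -/
theorem apply_eq_of_mem_ballChart_source [IsManifold 𝓘(ℂ, E) ω X]
    (hf : MDifferentiable 𝓘(ℂ, E × EuclideanSpace ℂ (Fin n)) 𝓘(ℂ, ℂ) f) {v : unitBall n} {M : ℂ}
    (hM : ∀ (x : X) (c : Circle), ‖f (χ.bundleMk E x (c • v))‖ ≤ ‖M‖) {i y y' : X}
    (hy : y ∈ (ballChart E i).source) (hy' : y' ∈ (ballChart E i).source) (c : Circle)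
    (h : f (χ.bundleMk E y ((χ.primitive E i y * c) • v)) = M) :
    f (χ.bundleMk E y' ((χ.primitive E i y' * c) • v)) = M := by
  set g : E → ℂ := fun a => f ((χ.bundleChart E n i).symm (a, (c • v : unitBall n).1)) with hg
  have hpair : Differentiable ℂ fun a : E => (a, (c • v : unitBall n).1) :=
    differentiable_id.prodMk (differentiable_const _)
  have hgd : DifferentiableOn ℂ g (ballChart E i).target :=
    (differentiableOn_comp_bundleChart_symm hf i).comp hpair.differentiableOn
      fun a ha => (χ.mem_bundleChart_target E n).2 ⟨ha, unitBall_norm_lt_one (c • v)⟩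
  have hga (a : E) : g a = f (χ.bundleMk E ((chartAt E i).symm a)
      ((χ.primitive E i ((chartAt E i).symm a) * c) • v)) := by
    rw [hg, mul_smul]
    exact congrArg f (χ.bundleChart_symm_apply E n _)
  have hgy (x : X) (hx : x ∈ (ballChart E i).source) :
      g (ballChart E i x) = f (χ.bundleMk E x ((χ.primitive E i x * c) • v)) := by
    rw [hga, ballChart_coe, (chartAt E i).left_inv (ballChart_source_subset i hx)]
  have hconn : IsPreconnected (ballChart E i).target := by
    rw [ballChart_target]
    exact (convex_ball _ _).isPreconnected
  have hmax : IsMaxOn (norm ∘ g) (ballChart E i).target (ballChart E i y) := by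
    refine isMaxOn_iff.2 fun a _ => ?_
    rw [Function.comp_apply, Function.comp_apply, hgy y hy, h, hga]
    exact hM _ _
  have hconst : g (ballChart E i y') = g (ballChart E i y) :=
    Complex.eqOn_of_isPreconnected_of_isMaxOn_norm hconn (ballChart E i).open_target hgd
      ((ballChart E i).map_source hy) hmax ((ballChart E i).map_source hy')
  rw [← hgy y' hy', hconst, hgy y hy, h]

theorem apply_eq_iff_of_path [IsManifold 𝓘(ℂ, E) ω X]
    (hf : MDifferentiable 𝓘(ℂ, E × EuclideanSpace ℂ (Fin n)) 𝓘(ℂ, ℂ) f) {v : unitBall n} {M : ℂ}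
    (hM : ∀ (x : X) (c : Circle), ‖f (χ.bundleMk E x (c • v))‖ ≤ ‖M‖) (γ : C(I, X)) (c : Circle) :
    f (χ.bundleMk E (γ 0) (c • v)) = M ↔
      f (χ.bundleMk E (γ 1) ((c * χ.toFun γ) • v)) = M := by
  let P : I → Prop := fun t =>
    f (χ.bundleMk E (γ t) ((c * χ.toFun (subpath γ 0 t)) • v)) = M
  have hP : IsLocallyConstant P := by
    refine (IsLocallyConstant.iff_eventually_eq P).2 fun t => ?_
    obtain ⟨δ, hδ, hδs⟩ := Metric.mem_nhds_iff.1 (γ.continuous.continuousAt.preimage_mem_nhds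
      ((ballChart E (γ t)).open_source.mem_nhds (mem_ballChart_source E (γ t))))
    filter_upwards [Metric.ball_mem_nhds t hδ] with t' ht'
    have hpath (s : I) : subpath γ t t' s ∈ (ballChart E (γ t)).source := by
      have hmem : (t : ℝ) + s * (t' - t) ∈ Set.Icc (0 : ℝ) 1 := by
        have := (convex_Icc (0 : ℝ) 1).add_smul_sub_mem t.2 t'.2 s.2
        simpa using this
      rw [subpath_apply, Set.projIcc_of_mem _ hmem]
      refine hδs (Metric.mem_ball.2 (lt_of_le_of_lt ?_ (Metric.mem_ball.1 ht')))
      rw [Subtype.dist_eq, Subtype.dist_eq, Real.dist_eq, Real.dist_eq, add_sub_cancel_left,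
        abs_mul, abs_of_nonneg s.2.1]
      exact mul_le_of_le_one_left (abs_nonneg _) s.2.2
    have hprim := χ.primitive_path (γ t) (subpath γ t t') hpath
    rw [subpath_zero, subpath_one] at hprim
    have h0 := hpath 0
    have h1 := hpath 1
    rw [subpath_zero] at h0
    rw [subpath_one] at h1
    -- `μ` is the constant scalar of the leaf in the trivialization at `γ t`.
    set μ : Circle := c * χ.toFun (subpath γ 0 t) / χ.primitive E (γ t) (γ t) with hμ
    have e0 : c * χ.toFun (subpath γ 0 t) = χ.primitive E (γ t) (γ t) * μ := by
      rw [hμ, mul_div_cancel]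
    have e1 : c * χ.toFun (subpath γ 0 t') = χ.primitive E (γ t) (γ t') * μ := by
      rw [hprim, mul_right_comm, ← e0, mul_assoc, χ.map_subpath_mul]
    refine propext ?_
    simp only [P, e0, e1]
    exact ⟨apply_eq_of_mem_ballChart_source hf hM h1 h0 μ,
      apply_eq_of_mem_ballChart_source hf hM h0 h1 μ⟩
  have h01 : P 0 = P 1 := hP.apply_eq_of_preconnectedSpace 0 1
  simp only [P, subpath_self, χ.map_const, mul_one, subpath_zero_one] at h01
  exact h01.to_iff

theorem apply_eq_of_dense [IsManifold 𝓘(ℂ, E) ω X] [ConnectedSpace X]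
    (hχ : ∀ (G : Subgroup Circle) (s : X → Circle),
      (∀ γ : C(I, X), χ.toFun γ * s (γ 0) / s (γ 1) ∈ G) → Dense (G : Set Circle))
    (hf : MDifferentiable 𝓘(ℂ, E × EuclideanSpace ℂ (Fin n)) 𝓘(ℂ, ℂ) f) {v : unitBall n} {M : ℂ}
    (hM : ∀ (x : X) (c : Circle), ‖f (χ.bundleMk E x (c • v))‖ ≤ ‖M‖) {x₀ : X}
    (h₀ : f (χ.bundleMk E x₀ v) = M) (y : X) (c : Circle) :
    f (χ.bundleMk E y (c • v)) = M := by
  have : LocallyPathConnectedSpace X := ChartedSpace.locallyPathConnectedSpace E X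
  have : PathConnectedSpace X := pathConnectedSpace_iff_connectedSpace.2 inferInstance
  let p (y : X) : Path x₀ y := PathConnectedSpace.somePath x₀ y
  let s (y : X) : Circle := χ.toFun (p y)
  have hs (y : X) (c : Circle) : f (χ.bundleMk E x₀ (c • v)) = M ↔
      f (χ.bundleMk E y ((c * s y) • v)) = M := by
    have := apply_eq_iff_of_path hf hM (p y).toContinuousMap c
    simp only [Path.coe_toContinuousMap, Path.source, Path.target] at this
    exact this
  -- Scalars whose multiplication preserves the set of `c` with `f = M` at `c • v` over `x₀`. Going
  -- out along `p (γ 0)`, then `γ`, and back along `p (γ 1)` places each gauged cocycle value in it.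
  let G : Subgroup Circle :=
    { carrier := {μ | ∀ c : Circle, f (χ.bundleMk E x₀ (c • v)) = M ↔
        f (χ.bundleMk E x₀ ((c * μ) • v)) = M}
      one_mem' := fun c => by rw [mul_one]
      mul_mem' := fun {a b} ha hb c => by rw [← mul_assoc]; exact (ha c).trans (hb _)
      inv_mem' := fun {a} ha c => by
        have := ha (c * a⁻¹)
        rw [inv_mul_cancel_right] at this
        exact this.symm }
  have hG : Dense (G : Set Circle) := by
    refine hχ G s fun γ c => ?_
    rw [hs (γ 0) c, apply_eq_iff_of_path hf hM γ, hs (γ 1) (c * _)]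
    have : c * s (γ 0) * χ.toFun γ = c * (χ.toFun γ * s (γ 0) / s (γ 1)) * s (γ 1) := by
      rw [mul_assoc, mul_assoc, div_mul_cancel, mul_comm (s (γ 0))]
    rw [this]
  have hclosed : IsClosed {c : Circle | f (χ.bundleMk E x₀ (c • v)) = M} := by
    have hc : Continuous fun c : Circle => χ.bundleMk E x₀ (c • v) :=
      ((χ.ballBundleCore E n).continuous_totalSpaceMk x₀).comp
        (continuous_id.smul continuous_const : Continuous fun c : Circle => c • v)
    exact isClosed_eq (hf.continuous.comp hc) continuous_const
  have huniv : {c : Circle | f (χ.bundleMk E x₀ (c • v)) = M} = Set.univ := by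
    refine Set.eq_univ_of_univ_subset ?_
    rw [← hG.closure_eq]
    refine closure_minimal (fun μ hμ => ?_) hclosed
    have := (hμ 1).1 (by rwa [one_smul])
    rwa [one_mul] at this
  have := (hs y (c / s y)).1 (huniv.symm.subset (Set.mem_univ _))
  rwa [div_mul_cancel] at this

/-- The value `M` is moved to the centre first because `v` may lie on the boundary `ρ = t`, where
the maximum principle gives nothing. -/
theorem apply_fiber_eq_of_isMaxOn [IsManifold 𝓘(ℂ, E) ω X]
    (hf : MDifferentiable 𝓘(ℂ, E × EuclideanSpace ℂ (Fin n)) 𝓘(ℂ, ℂ) f) {v : unitBall n} {M : ℂ}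
    {y : X} (hv : ∀ c : Circle, f (χ.bundleMk E y (c • v)) = M) {t : ℝ}
    (hM : ∀ z : χ.BallBundle E n, χ.fiberNormSq z ≤ t → ‖f z‖ ≤ ‖M‖)
    {w : unitBall n} (hw : ‖w.1‖ ^ 2 < t) :
    f (χ.bundleMk E y ⟨0, by simp [mem_unitBall]⟩) = M ∧ f (χ.bundleMk E y w) = M := by
  set g : EuclideanSpace ℂ (Fin n) → ℂ :=
    fun w => f ((χ.bundleChart E n y).symm (chartAt E y y, w)) with hg
  have hgd : DifferentiableOn ℂ g (Metric.ball 0 1) :=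
    (differentiableOn_comp_bundleChart_symm hf y).comp
      (by fun_prop : DifferentiableOn ℂ
        (fun w : EuclideanSpace ℂ (Fin n) => (chartAt E y y, w)) _)
      fun w hw => (χ.mem_bundleChart_target E n).2
        ⟨(ballChart E y).map_source (mem_ballChart_source E y), mem_ball_zero_iff.1 hw⟩
  have hgw (w : unitBall n) : g w.1 = f (χ.bundleMk E y w) := by
    rw [hg]
    refine congrArg f ((χ.bundleChart_symm_apply E n w).trans ?_)
    rw [(chartAt E y).left_inv (mem_chart_source E y), χ.primitive_self E, one_smul]
  have h0 : g 0 = M := by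
    have hd : DiffContOnCl ℂ (fun ζ : ℂ => g (ζ • v.1)) (Metric.ball 0 1) := by
      refine DifferentiableOn.diffContOnCl (hgd.comp (by fun_prop) fun ζ hζ => ?_)
      rw [closure_ball _ one_ne_zero, mem_closedBall_zero_iff] at hζ
      rw [mem_ball_zero_iff, norm_smul]
      exact (mul_le_of_le_one_left (norm_nonneg _) hζ).trans_lt (unitBall_norm_lt_one v)
    have := Complex.eqOn_of_eqOn_frontier Metric.isBounded_ball hd
      (diffContOnCl_const (c := M)) (fun ζ hζ => ?_) (Metric.mem_ball_self one_pos)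
    · simpa using this
    · rw [frontier_ball _ one_ne_zero] at hζ
      have := hgw ((show Circle from ⟨ζ, hζ⟩) • v)
      rw [hv] at this
      exact this
  refine ⟨(hgw ⟨0, by simp [mem_unitBall]⟩).symm.trans h0, ?_⟩
  have ht : 0 < t := (sq_nonneg _).trans_lt hw
  have hmem (w : EuclideanSpace ℂ (Fin n)) (hw : w ∈ Metric.ball 0 1 ∩ Metric.ball 0 √t) :
      ‖g w‖ ≤ ‖M‖ := by
    have := hgw ⟨w, hw.1⟩
    rw [this]
    refine hM _ ?_
    change ‖w‖ ^ 2 ≤ t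
    exact (Real.lt_sqrt (norm_nonneg _)).1 (mem_ball_zero_iff.1 hw.2) |>.le
  -- Nothing bounds `t` by `1` here, hence the intersection of the two balls.
  have hconn : IsPreconnected
      (Metric.ball (0 : EuclideanSpace ℂ (Fin n)) 1 ∩ Metric.ball 0 √t) :=
    ((convex_ball _ _).inter (convex_ball _ _)).isPreconnected
  have := Complex.eqOn_of_isPreconnected_of_isMaxOn_norm hconn
    (Metric.isOpen_ball.inter Metric.isOpen_ball) (hgd.mono Set.inter_subset_left)
    ⟨Metric.mem_ball_self one_pos, Metric.mem_ball_self (Real.sqrt_pos.2 ht)⟩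
    (fun w hw => by
      change ‖g w‖ ≤ ‖g 0‖
      rw [h0]
      exact hmem w hw)
    (⟨w.2, mem_ball_zero_iff.2 ((Real.lt_sqrt (norm_nonneg _)).2 hw)⟩ :
      w.1 ∈ Metric.ball (0 : EuclideanSpace ℂ (Fin n)) 1 ∩ Metric.ball 0 √t)
  rw [← hgw w]
  exact this.trans h0

theorem exists_eq_const [IsManifold 𝓘(ℂ, E) ω X] [ConnectedSpace X] [CompactSpace X] [T2Space X]
    (hχ : ∀ (G : Subgroup Circle) (s : X → Circle),
      (∀ γ : C(I, X), χ.toFun γ * s (γ 0) / s (γ 1) ∈ G) → Dense (G : Set Circle))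
    (hf : MDifferentiable 𝓘(ℂ, E × EuclideanSpace ℂ (Fin n)) 𝓘(ℂ, ℂ) f) :
    ∃ c : ℂ, ∀ z, f z = c := by
  obtain ⟨x₀⟩ : Nonempty X := inferInstance
  refine ⟨f (χ.bundleMk E x₀ ⟨0, by simp [mem_unitBall]⟩), fun z => ?_⟩
  -- The level depends on `z`, and so does the maximal value; comparison with the centre of the
  -- fibre over the fixed `x₀` removes this dependence.
  obtain ⟨t, hzt, ht1⟩ := exists_between (χ.fiberNormSq_lt_one z)
  obtain ⟨z₀, hz₀, hmax⟩ := (χ.isCompact_fiberNormSq_le E n ht1).exists_isMaxOn ⟨z, hzt.le⟩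
    hf.continuous.norm.continuousOn
  have hM (z : χ.BallBundle E n) (hz : χ.fiberNormSq z ≤ t) : ‖f z‖ ≤ ‖f z₀‖ := hmax hz
  have hv := apply_eq_of_dense hχ hf (v := χ.fiberCoord z₀) (M := f z₀) (fun x c => hM _ (by
    change ‖((_ : Circle) : ℂ) • (χ.fiberCoord z₀).1‖ ^ 2 ≤ t
    rw [norm_smul, Circle.norm_coe, one_mul]
    exact hz₀)) (x₀ := z₀.1) rfl
  have h1 := apply_fiber_eq_of_isMaxOn hf (hv z.1) hM (w := χ.fiberCoord z) hzt
  have h2 := apply_fiber_eq_of_isMaxOn hf (hv x₀) hM (w := χ.fiberCoord z) hzt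
  exact h1.2.trans h2.1.symm

end CircleCocycle

end Holomorphic

theorem mainTheorem4 (m : ℕ) (X : Type u) [TopologicalSpace X] [T2Space X] [CompactSpace X]
    [ConnectedSpace X] [ChartedSpace (EuclideanSpace ℂ (Fin m)) X]
    [IsManifold 𝓘(ℂ, EuclideanSpace ℂ (Fin m)) ω X]
    (hX : 0 < firstBettiNumber X) (n : ℕ) (hn : 1 ≤ n) :
    ∃ (Ω : Type u) (_ : TopologicalSpace Ω)
      (_ : ChartedSpace (EuclideanSpace ℂ (Fin m) × EuclideanSpace ℂ (Fin n)) Ω),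
      T2Space Ω ∧ SecondCountableTopology Ω ∧
      IsManifold 𝓘(ℂ, EuclideanSpace ℂ (Fin m) × EuclideanSpace ℂ (Fin n)) ω Ω ∧
      (∃ p : Ω → X,
        IsFlatBundle 𝓘(ℂ, EuclideanSpace ℂ (Fin m)) 𝓘(ℂ, EuclideanSpace ℂ (Fin n))
          𝓘(ℂ, EuclideanSpace ℂ (Fin m) × EuclideanSpace ℂ (Fin n)) (unitBall n) p) ∧
      (∃ ρ : Ω → ℝ,
        IsRealAnalytic (EuclideanSpace ℂ (Fin m) × EuclideanSpace ℂ (Fin n)) ρ ∧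
        IsBoundedExhaustion ρ ∧
        IsPlurisubharmonic (EuclideanSpace ℂ (Fin m) × EuclideanSpace ℂ (Fin n)) ρ ∧
        HessianHasPositiveEigenvalues (stdBasisProd m n) n ρ) ∧
      (∀ f : Ω → ℂ,
        MDifferentiable 𝓘(ℂ, EuclideanSpace ℂ (Fin m) × EuclideanSpace ℂ (Fin n)) 𝓘(ℂ, ℂ) f →
          ∃ c : ℂ, ∀ z : Ω, f z = c) := by
  obtain ⟨χ, hχ⟩ := exists_circleCocycle X hX
  exact ⟨χ.BallBundle (EuclideanSpace ℂ (Fin m)) n, inferInstance, inferInstance, inferInstance,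
    χ.secondCountable_ballBundle _ n, inferInstance, ⟨_, χ.isFlatBundle_proj _ n⟩,
    ⟨χ.fiberNormSq, χ.isRealAnalytic_fiberNormSq _ n, χ.isBoundedExhaustion_fiberNormSq _ n,
      χ.isPlurisubharmonic_fiberNormSq _ n, χ.hessianHasPositiveEigenvalues_fiberNormSq n⟩,
    fun f hf => CircleCocycle.exists_eq_const hχ hf⟩
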